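/- Let $n\ge 0$ and let $d$ be a metric on $\mathbb{R}^n$ that is continuous on $\mathbb{R}^n\times\mathbb{R}^n$ for the usual topology and has approximate midpoints: for all $x,y$ and all $r>d(x,y)/2$ there is $m$ with $d(x,m)<r$ and $d(m,y)<r$ (for example, any metric induced by a norm, such as the Euclidean one). Let $\varepsilon\ge 0$. Let $\nu$ be a Borel probability measure on $\mathbb{R}^n\times\{0,1\}$, let $(X,Y)\sim\nu$ and $w_i=\mathbb{P}(Y=i)$, and suppose that, for $i=0,1$, the conditional distribution of $X$ given $Y=i$ has a probability density $\rho_i$ with respect to Lebesgue measure, i.e. $\nu(E\times\{i\})=w_i\int_E\rho_i\,dx$ for all Borel sets $E$. (The weights $w_0,w_1\ge 0$ with $w_0+w_1=1$ are otherwise arbitrary.) Let $\nu^S$ be the measure obtained from $\nu$ by swapping the labels, $\nu^S(E\times\{1\})=\nu(E\times\{0\})$ and $\nu^S(E\times\{0\})=\nu(E\times\{1\})$, and let $\Gamma(\nu,\nu^S)$ be the set of couplings of $\nu$ and $\nu^S$. For $z_i=(x_i,y_i)$ let $c_\varepsilon(z_1,z_2)=1$ if $d(x_1,x_2)>2\varepsilon$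 or $y_1\ne y_2$, and $c_\varepsilon(z_1,z_2)=0$ otherwise. For a set $A\subseteq\mathbb{R}^n$ and $s\in\mathbb{R}$ let $A^s=\{x:\tilde d_A(x)\le s\}$, where $\tilde d_A(x)=\inf_{y\in A}d(x,y)$ if $x\notin A$ and $\tilde d_A(x)=-\inf_{y\in A^c}d(x,y)$ if $x\in A$ (with $\inf\emptyset=+\infty$). Then, with the suprema (which are finite) taken over all Borel subsets of $\mathbb{R}^n$, \[ 2\sup_{B}\Big\{\int_{B^{-\varepsilon}}w_1\rho_1\,dx-\int_{B^{\varepsilon}}w_0\rho_0\,dx\Big\}-w_1+w_0 =\inf_{\pi\in\Gamma(\nu,\nu^S)}\int c_\varepsilon(z_1,z_2)\,d\pi(z_1,z_2) \] and \[ 2\sup_{A}\Big\{\int_{A^{-\varepsilon}}w_0\rho_0\,dx-\int_{A^{\varepsilon}}w_1\rho_1\,dx\Big\}-w_0+w_1 =\inf_{\pi\in\Gamma(\nu,\nu^S)}\int c_\varepsilon(z_1,z_2)\,d\pi(z_1,z_2). \] -/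

import Mathlib

open MeasureTheory

noncomputable section

/-- The Euclidean space `ℝⁿ`, carrying its usual topology, Borel sets and Lebesgue measure. -/
abbrev RSpace (n : ℕ) : Type := EuclideanSpace ℝ (Fin n)

/-- The space of labelled points `z = (x, y)`, with label `y ∈ {0, 1}`. -/
abbrev Labelled (n : ℕ) : Type := RSpace n × Fin 2

/-- `d` is a metric on the set `X`. -/
structure IsMetric {X : Type*} (d : X → X → ℝ) : Prop where
  eq_zero_iff : ∀ x y, d x y = 0 ↔ x = y
  symm : ∀ x y, d x y = d y x
  triangle : ∀ x y z, d x z ≤ d x y + d y z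

/-- Approximate midpoints: every length metric (in particular every metric that comes from
a norm) has them. -/
def HasApproxMidpoints {X : Type*} (d : X → X → ℝ) : Prop :=
  ∀ x y, ∀ r : ℝ, d x y / 2 < r → ∃ m, d x m < r ∧ d m y < r

/-- The distance `d(x, A) = inf_{y ∈ A} d(x, y)`; it is `+∞` if `A` is empty. -/
def distToSet {X : Type*} (d : X → X → ℝ) (x : X) (A : Set X) : EReal :=
  ⨅ y ∈ A, (d x y : EReal)

open Classical in
/-- The signed distance to `A`: `d(x, A)` outside of `A` and `-d(x, Aᶜ)` inside of `A`. -/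
def signedDistTo {X : Type*} (d : X → X → ℝ) (A : Set X) (x : X) : EReal :=
  if x ∈ A then -distToSet d x Aᶜ else distToSet d x A

/-- The set `A^s` of all points whose signed distance to `A` is at most `s`:
a dilation of `A` for `s > 0` and an erosion of `A` for `s < 0`. -/
def offset {X : Type*} (d : X → X → ℝ) (A : Set X) (s : ℝ) : Set X :=
  {x | signedDistTo d A x ≤ (s : EReal)}

/-- `f` is a probability density on `ℝⁿ` with respect to Lebesgue measure. -/
structure IsProbDensity {n : ℕ} (f : RSpace n → ℝ) : Prop where
  measurable : Measurable f
  nonneg : ∀ x, 0 ≤ f x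
  lintegral_eq_one : ∫⁻ x, ENNReal.ofReal (f x) = 1

/-- The class weight `w_i = P(Y = i)` for `(X, Y) ∼ ν`. -/
def classWeight {n : ℕ} (ν : Measure (Labelled n)) (i : Fin 2) : ℝ :=
  ν.real (Set.univ ×ˢ {i})

/-- For `(X, Y) ∼ ν`, the conditional distribution of `X` given `Y = i` is `f dx`, that is,
`P(X ∈ E, Y = i) = P(Y = i) ∫_E f dx` for all Borel sets `E`. -/
def HasConditionalDensity {n : ℕ} (ν : Measure (Labelled n)) (i : Fin 2)
    (f : RSpace n → ℝ) : Prop :=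
  ∀ E : Set (RSpace n), MeasurableSet E →
    ν (E ×ˢ {i}) = ν (Set.univ ×ˢ {i}) * ∫⁻ x in E, ENNReal.ofReal (f x)

/-- The distribution `ν^S`: the image of `ν` when the two labels are swapped. -/
def labelSwap {n : ℕ} (ν : Measure (Labelled n)) : Measure (Labelled n) :=
  ν.map (fun z => (z.1, Equiv.swap (0 : Fin 2) 1 z.2))

/-- `π ∈ Γ(μ, ν)`: `π` has first marginal `μ` and second marginal `ν`. -/
def IsCoupling {Z : Type*} [MeasurableSpace Z] (π : Measure (Z × Z)) (μ ν : Measure Z) : Prop :=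
  π.map Prod.fst = μ ∧ π.map Prod.snd = ν

/-- The cost `c_ε(z₁, z₂)`: it is `1` if `d(x₁, x₂) > 2ε` or `y₁ ≠ y₂`, and `0` otherwise. -/
def advCost {X : Type*} (d : X → X → ℝ) (ε : ℝ) (z₁ z₂ : X × Fin 2) : ℝ :=
  if d z₁.1 z₂.1 > 2 * ε ∨ z₁.2 ≠ z₂.2 then 1 else 0

/-- The number `∫_{B^{-ε}} f dx - ∫_{B^ε} g dx`. -/
def robustGain {n : ℕ} (d : RSpace n → RSpace n → ℝ) (ε : ℝ) (f g : RSpace n → ℝ)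
    (B : Set (RSpace n)) : ℝ :=
  (∫ x in offset d B (-ε), f x) - ∫ x in offset d B ε, g x

end

/-! Write `m₀`, `m₁` for the two label parts of `ν`; those of `labelSwap ν` are `m₁`, `m₀`. The cost
is the indicator of the complement of the closed relation `freeRel`, so the transport problem asks
how little mass a coupling can put off this relation. Strassen's theorem
(`exists_coupling_compl_le`) reduces this to bounding `ν K - ν^S (R[K])` for compact `K`. Zero-cost
moves preserve labels, so the bound splits into two problems on `ℝⁿ`, and testing with the closed
`ε`-neighbourhood of each slice bounds the difference by `maxGain m₀ m₁ + maxGain m₁ m₀`.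

Conversely, approximate midpoints put the closed `2ε`-neighbourhood of `B^{-ε}` inside `B^ε`
(`mem_offset_of_le`), so every coupling costs at least this sum. Finally, passing to complements
gives `maxGain m₀ m₁ - w₀ = maxGain m₁ m₀ - w₁` (`maxGain_le_maxGain_swap` in both directions),
which turns the sum into either formula.

Strassen's theorem itself comes from M. Riesz extension of a positive functional: the dual estimate,
a layer cake argument, makes the extension possible, and tightness of the marginals makes the
functional a measure. -/

/-! ### Riesz representation of tight functionals -/

open BoundedContinuousFunction CompactlySupported in
/-- A positive linear functional on the bounded continuous functions that is tight is the
integral against a finite measure. -/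
theorem exists_measure_of_tight {X : Type*} [TopologicalSpace X] [T2Space X]
    [LocallyCompactSpace X] [MeasurableSpace X] [BorelSpace X]
    (L : (X →ᵇ ℝ) →ₗ[ℝ] ℝ) (hpos : ∀ h : X →ᵇ ℝ, (∀ x, 0 ≤ h x) → 0 ≤ L h)
    (htight : ∀ δ : ℝ, 0 < δ → ∃ K : Set X, IsCompact K ∧ ∀ h : X →ᵇ ℝ,
      (∀ x, 0 ≤ h x ∧ h x ≤ 1) → (∀ x ∈ K, h x = 0) → L h ≤ δ) :
    ∃ π : Measure X, IsFiniteMeasure π ∧ ∀ h : X →ᵇ ℝ, ∫ x, h x ∂π = L h := by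
  have hmono : ∀ f g : X →ᵇ ℝ, (∀ x, f x ≤ g x) → L f ≤ L g := fun f g h => by
    have := hpos (g - f) fun x => by simpa using h x
    rw [map_sub] at this
    linarith
  let Λ : C_c(X, ℝ) →ₚ[ℝ] ℝ :=
  { toFun f := L f.toBoundedContinuousFunction
    map_add' f g := by
      rw [← map_add]; rfl
    map_smul' c f := by
      rw [← map_smul]; rfl
    monotone' f g hfg := hmono _ _ hfg }
  have hΛ : ∀ f : C_c(X, ℝ), ∫ x, f x ∂(RealRMK.rieszMeasure Λ) = L f.toBoundedContinuousFunction :=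
    fun f => RealRMK.integral_rieszMeasure Λ f
  set π := RealRMK.rieszMeasure Λ with hπ
  have hcut : ∀ K : Set X, IsCompact K → ∃ χ : C_c(X, ℝ), (∀ x ∈ K, χ x = 1) ∧
      ∀ x, 0 ≤ χ x ∧ χ x ≤ 1 := fun K hK => by
    obtain ⟨f, h1, -, hc, h01⟩ := exists_continuous_one_zero_of_isCompact hK isClosed_empty
      (Set.disjoint_empty K)
    exact ⟨⟨f, hc⟩, fun x hx => h1 hx, h01⟩
  have hfin : IsFiniteMeasure π := by
    refine ⟨lt_of_le_of_lt ?_ (ENNReal.ofReal_lt_top (r := L 1))⟩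
    rw [isOpen_univ.measure_eq_iSup_isCompact]
    refine iSup₂_le fun K _ => iSup_le fun hK => ?_
    obtain ⟨χ, h1, h01⟩ := hcut K hK
    refine (RealRMK.rieszMeasure_le_of_eq_one Λ (fun x => (h01 x).1) hK h1).trans ?_
    exact ENNReal.ofReal_le_ofReal (hmono _ _ fun x => (h01 x).2)
  refine ⟨π, hfin, fun h => ?_⟩
  -- A cutoff `χ` equal to 1 where both `L` and `π` concentrate splits `h`. The compactly supported
  -- part `h * c` is integrated exactly; the rest costs at most `‖h‖ * δ` on each side.
  have key : ∀ δ : ℝ, 0 < δ → |∫ x, h x ∂π - L h| ≤ ‖h‖ * δ + ‖h‖ * δ := by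
    intro δ hδ
    obtain ⟨K, hK, hKL⟩ := htight δ hδ
    obtain ⟨K', -, hK', hπK'⟩ := MeasurableSet.univ.exists_isCompact_sdiff_lt
      (measure_ne_top π Set.univ) (ε := ENNReal.ofReal δ) (by simpa using hδ)
    obtain ⟨χ, h1, h01⟩ := hcut (K ∪ K') (hK.union hK')
    let c : X →ᵇ ℝ := χ.toBoundedContinuousFunction
    have hc : ∀ x, c x = χ x := fun _ => rfl
    have e1 : L (h * c) = ∫ x, (h * c) x ∂π := by
      let f : C_c(X, ℝ) := ⟨⟨fun x => h x * χ x, h.continuous.mul χ.continuous⟩,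
        χ.hasCompactSupport.mul_left⟩
      exact (hΛ f).symm
    have hsplit : h = h * c + h * (1 - c) := by ring
    have hb : ∀ x, |h x * (1 - χ x)| ≤ ‖h‖ * (1 - χ x) := fun x => by
      rw [abs_mul, abs_of_nonneg (sub_nonneg.2 (h01 x).2)]
      exact mul_le_mul_of_nonneg_right (h.norm_coe_le_norm x) (sub_nonneg.2 (h01 x).2)
    have e2 : L (1 - c) ≤ δ := hKL _ (fun x => by
      have := h01 x
      simp only [coe_sub, coe_one, Pi.sub_apply, Pi.one_apply, hc]
      constructor <;> linarith) fun x hx => by simp [hc, h1 x (Or.inl hx)]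
    have e3 : |L (h * (1 - c))| ≤ ‖h‖ * δ := by
      have a1 : L (h * (1 - c)) ≤ L (‖h‖ • (1 - c)) :=
        hmono _ _ fun x => (le_abs_self _).trans (hb x)
      have a2 : L (-(h * (1 - c))) ≤ L (‖h‖ • (1 - c)) :=
        hmono _ _ fun x => (neg_le_abs _).trans (hb x)
      rw [map_smul, smul_eq_mul] at a1 a2
      rw [map_neg] at a2
      have a3 : ‖h‖ * L (1 - c) ≤ ‖h‖ * δ := mul_le_mul_of_nonneg_left e2 (norm_nonneg h)
      exact abs_le.2 ⟨by linarith, by linarith⟩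
    have e4 : ∫ x, (1 - c) x ∂π ≤ δ := by
      have hind : ∫ x, (1 - c) x ∂π ≤ ∫ x, (Set.univ \ K').indicator 1 x ∂π := by
        refine integral_mono ((1 - c).integrable π) ?_ fun x => ?_
        · exact (integrable_const (1 : ℝ)).indicator (MeasurableSet.univ.diff hK'.measurableSet)
        · by_cases hx : x ∈ K'
          · simp [hx, hc, h1 x (Or.inr hx)]
          · simpa [hx, hc] using (h01 x).1
      rw [integral_indicator_one (MeasurableSet.univ.diff hK'.measurableSet)] at hind
      exact hind.trans (ENNReal.toReal_le_of_le_ofReal hδ.le hπK'.le)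
    have e5 : |∫ x, (h * (1 - c)) x ∂π| ≤ ‖h‖ * δ := by
      refine (abs_integral_le_integral_abs).trans ?_
      refine (integral_mono ((h * (1 - c)).integrable π).abs
        (((1 - c).integrable π).const_mul ‖h‖) hb).trans ?_
      rw [integral_const_mul]
      exact mul_le_mul_of_nonneg_left e4 (norm_nonneg h)
    have e6 : ∫ x, h x ∂π = ∫ x, (h * c) x ∂π + ∫ x, (h * (1 - c)) x ∂π := by
      rw [← integral_add ((h * c).integrable π) ((h * (1 - c)).integrable π)]
      exact integral_congr_ae (.of_forall fun x => DFunLike.congr_fun hsplit x)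
    have e7 : L h = L (h * c) + L (h * (1 - c)) := by
      rw [← map_add, ← hsplit]
    rw [e6, e7, e1]
    calc _ = |∫ x, (h * (1 - c)) x ∂π - L (h * (1 - c))| := by congr 1; ring
      _ ≤ _ := (abs_sub _ _).trans (add_le_add e5 e3)
  by_contra hne
  have hp : 0 < |∫ x, h x ∂π - L h| := abs_pos.2 (sub_ne_zero.2 hne)
  have hk := key (|∫ x, h x ∂π - L h| / (4 * (‖h‖ + 1))) (by positivity)
  have : 0 ≤ ‖h‖ := norm_nonneg h
  have h4 : ‖h‖ * (|∫ x, h x ∂π - L h| / (4 * (‖h‖ + 1))) ≤ |∫ x, h x ∂π - L h| / 4 := by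
    rw [mul_div_assoc', div_le_div_iff₀ (by positivity) (by norm_num)]
    nlinarith
  linarith

/-! ### Strassen's theorem for a closed relation -/

/-- The image of `K` under the relation `R`. -/
def relImage {Z : Type*} (R : Set (Z × Z)) (K : Set Z) : Set Z := {y | ∃ x ∈ K, (x, y) ∈ R}

/-- Projection along a compact factor is a closed map. -/
theorem isClosed_relImage {Z : Type*} [TopologicalSpace Z] {R : Set (Z × Z)} (hR : IsClosed R)
    {K : Set Z} (hK : IsCompact K) : IsClosed (relImage R K) := by
  have h : relImage R K = Prod.snd '' ((fun p : K × Z => ((p.1 : Z), p.2)) ⁻¹' R) := by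
    ext y
    simp [relImage]
  have := isCompact_iff_compactSpace.1 hK
  rw [h]
  exact isClosedMap_snd_of_compactSpace _ (hR.preimage (by fun_prop))

section
variable {Z : Type*} [TopologicalSpace Z] [MeasurableSpace Z] [BorelSpace Z]
  {μ ν : Measure Z} [IsProbabilityMeasure μ] [IsProbabilityMeasure ν]
  {R : Set (Z × Z)} {s : ℝ}

open BoundedContinuousFunction

/-- The dual estimate for potentials with values in `[0, 1]`, by the layer cake formula. -/
theorem le_integral_add_integral_of_mem_Icc [μ.InnerRegularCompactLTTop]
    (hs : ∀ K : Set Z, IsCompact K → μ.real K - ν.real (relImage R K) ≤ s)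
    (f g : Z →ᵇ ℝ) (hf : ∀ x, 0 ≤ f x ∧ f x ≤ 1) (hg : ∀ x, 0 ≤ g x ∧ g x ≤ 1)
    (h : ∀ p ∈ R, 1 ≤ f p.1 + g p.2) :
    1 - s ≤ ∫ x, f x ∂μ + ∫ x, g x ∂ν := by
  have hF : Antitone fun t : ℝ => μ.real {x | t ≤ f x} := fun a b hab =>
    measureReal_mono fun x hx => hab.trans hx
  have hG : Antitone fun t : ℝ => ν.real {x | t ≤ g x} := fun a b hab =>
    measureReal_mono fun x hx => hab.trans hx
  have ef : ∫ x, f x ∂μ = ∫ t in (0 : ℝ)..1, μ.real {x | t ≤ f x} := by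
    rw [intervalIntegral.integral_of_le zero_le_one]
    exact (f.integrable μ).integral_eq_integral_Ioc_meas_le (.of_forall fun x => (hf x).1)
      (.of_forall fun x => (hf x).2)
  -- Levels of `g` are reversed to match those of `f`: along `R`, `f x < t` forces `1 - t ≤ g y`, so
  -- `R` maps `{f < t}` into `{1 - t ≤ g}`.
  have eg : ∫ x, g x ∂ν = ∫ t in (0 : ℝ)..1, ν.real {x | 1 - t ≤ g x} := by
    rw [intervalIntegral.integral_comp_sub_left (fun t => ν.real {x | t ≤ g x})]
    simp only [sub_self, sub_zero]
    rw [intervalIntegral.integral_of_le zero_le_one]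
    exact (g.integrable ν).integral_eq_integral_Ioc_meas_le (.of_forall fun x => (hg x).1)
      (.of_forall fun x => (hg x).2)
  have hG' : Monotone fun t : ℝ => ν.real {x | 1 - t ≤ g x} := fun a b hab =>
    hG (by linarith : 1 - b ≤ 1 - a)
  rw [ef, eg, ← intervalIntegral.integral_add hF.intervalIntegrable hG'.intervalIntegrable]
  have hpt : ∀ t : ℝ, 1 - s ≤ μ.real {x | t ≤ f x} + ν.real {x | 1 - t ≤ g x} := by
    intro t
    have hA : MeasurableSet {x | f x < t} := (isOpen_lt f.continuous continuous_const).measurableSet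
    have hc : μ.real {x | t ≤ f x} = 1 - μ.real {x | f x < t} := by
      rw [← probReal_compl_eq_one_sub hA]
      congr 1
      ext x
      simp
    have hle : μ.real {x | f x < t} ≤ s + ν.real {x | 1 - t ≤ g x} := by
      refine le_of_forall_pos_le_add fun δ hδ => ?_
      obtain ⟨K, hKA, hK, hKδ⟩ := hA.exists_isCompact_lt_add (measure_ne_top μ _)
        (ε := ENNReal.ofReal δ) (by simpa using hδ)
      have h1 : μ.real {x | f x < t} ≤ μ.real K + δ := by
        have := ENNReal.toReal_mono (by finiteness) hKδ.le
        rwa [ENNReal.toReal_add (by finiteness) (by finiteness), ENNReal.toReal_ofReal hδ.le]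
          at this
      have h2 : ν.real (relImage R K) ≤ ν.real {x | 1 - t ≤ g x} := by
        refine measureReal_mono ?_
        rintro y ⟨x, hx, hxy⟩
        have a := h _ hxy
        have b : f x < t := hKA hx
        simp only [Set.mem_ofPred_eq] at a ⊢
        linarith
      linarith [hs K hK]
    linarith
  calc 1 - s = ∫ _ in (0 : ℝ)..1, (1 - s) := by simp
    _ ≤ _ := intervalIntegral.integral_mono_on zero_le_one (by simp)
      (hF.intervalIntegrable.add hG'.intervalIntegrable) fun t _ => hpt t

/-- The dual estimate for arbitrary bounded continuous potentials. -/
theorem mul_le_integral_add_integral [μ.InnerRegularCompactLTTop]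
    (hs : ∀ K : Set Z, IsCompact K → μ.real K - ν.real (relImage R K) ≤ s)
    (f g : Z →ᵇ ℝ) (t : ℝ) (ht : 0 ≤ t) (h0 : ∀ x y, 0 ≤ f x + g y)
    (h : ∀ p ∈ R, t ≤ f p.1 + g p.2) :
    t * (1 - s) ≤ ∫ x, f x ∂μ + ∫ x, g x ∂ν := by
  have : Nonempty Z := nonempty_of_isProbabilityMeasure μ
  have hbdd : BddBelow (Set.range f) := by
    obtain ⟨y⟩ := this
    exact ⟨-g y, by rintro _ ⟨x, rfl⟩; linarith [h0 x y]⟩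
  -- Replacing `f`, `g` by `f - a`, `g + a` makes both nonnegative without changing the sum of the
  -- potentials or, for probability measures, of the integrals. Truncating at 1 after division by
  -- `t` then keeps the sum at least 1 on `R`.
  set a := ⨅ x, f x with ha
  have hfa : ∀ x, a ≤ f x := fun x => ciInf_le hbdd x
  have hga : ∀ y, -a ≤ g y := fun y => by
    have : -g y ≤ a := le_ciInf fun x => by linarith [h0 x y]
    linarith
  rcases ht.eq_or_lt with rfl | ht
  · have h1 : ∫ _, a ∂μ ≤ ∫ x, f x ∂μ := integral_mono (integrable_const _) (f.integrable μ) hfa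
    have h2 : ∫ _, -a ∂ν ≤ ∫ x, g x ∂ν := integral_mono (integrable_const _) (g.integrable ν) hga
    simp only [integral_const, probReal_univ, one_smul] at h1 h2
    linarith
  let F : Z →ᵇ ℝ := BoundedContinuousFunction.ofNormedAddCommGroup
    (fun x => min 1 (t⁻¹ * (f x - a))) (by fun_prop) 1 fun x => by
      have : 0 ≤ t⁻¹ * (f x - a) := mul_nonneg (inv_nonneg.2 ht.le) (sub_nonneg.2 (hfa x))
      rw [Real.norm_eq_abs, abs_of_nonneg (le_min zero_le_one this)]
      exact min_le_left _ _
  let G : Z →ᵇ ℝ := BoundedContinuousFunction.ofNormedAddCommGroup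
    (fun x => min 1 (t⁻¹ * (g x + a))) (by fun_prop) 1 fun x => by
      have : 0 ≤ t⁻¹ * (g x + a) := mul_nonneg (inv_nonneg.2 ht.le) (by linarith [hga x])
      rw [Real.norm_eq_abs, abs_of_nonneg (le_min zero_le_one this)]
      exact min_le_left _ _
  have hF : ∀ x, F x = min 1 (t⁻¹ * (f x - a)) := fun _ => rfl
  have hG : ∀ x, G x = min 1 (t⁻¹ * (g x + a)) := fun _ => rfl
  have hf0 : ∀ x, 0 ≤ t⁻¹ * (f x - a) := fun x =>
    mul_nonneg (inv_nonneg.2 ht.le) (sub_nonneg.2 (hfa x))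
  have hg0 : ∀ x, 0 ≤ t⁻¹ * (g x + a) := fun x =>
    mul_nonneg (inv_nonneg.2 ht.le) (by linarith [hga x])
  have key := le_integral_add_integral_of_mem_Icc hs F G
    (fun x => ⟨le_min zero_le_one (hf0 x), min_le_left _ _⟩)
    (fun x => ⟨le_min zero_le_one (hg0 x), min_le_left _ _⟩) fun p hp => by
      have h1 : 1 ≤ t⁻¹ * (f p.1 - a) + t⁻¹ * (g p.2 + a) := by
        rw [← mul_add, inv_mul_eq_div, le_div_iff₀ ht]
        linarith [h p hp]
      have := hf0 p.1
      have := hg0 p.2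
      rw [hF, hG]
      rcases min_choice 1 (t⁻¹ * (f p.1 - a)) with e | e <;>
      rcases min_choice 1 (t⁻¹ * (g p.2 + a)) with e' | e' <;> rw [e, e'] <;> linarith
  have h1 : ∫ x, F x ∂μ ≤ t⁻¹ * (∫ x, f x ∂μ - a) := by
    have : ∫ x, t⁻¹ * (f x - a) ∂μ = t⁻¹ * (∫ x, f x ∂μ - a) := by
      rw [integral_const_mul, integral_sub (f.integrable μ) (integrable_const _)]
      simp
    rw [← this]
    exact integral_mono (F.integrable μ)
      (((f.integrable μ).sub (integrable_const a)).const_mul _) fun x => min_le_right _ _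
  have h2 : ∫ x, G x ∂ν ≤ t⁻¹ * (∫ x, g x ∂ν + a) := by
    have : ∫ x, t⁻¹ * (g x + a) ∂ν = t⁻¹ * (∫ x, g x ∂ν + a) := by
      rw [integral_const_mul, integral_add (g.integrable ν) (integrable_const _)]
      simp
    rw [← this]
    exact integral_mono (G.integrable ν)
      (((g.integrable ν).add (integrable_const a)).const_mul _) fun x => min_le_right _ _
  have h3 : 1 - s ≤ t⁻¹ * (∫ x, f x ∂μ + ∫ x, g x ∂ν) := by
    calc 1 - s ≤ _ := key
      _ ≤ _ := add_le_add h1 h2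
      _ = _ := by ring
  rw [inv_mul_eq_div, le_div_iff₀ ht] at h3
  linarith

end

section
variable {Z : Type*} [TopologicalSpace Z] [MeasurableSpace Z] [BorelSpace Z]
  {μ ν : Measure Z} [IsProbabilityMeasure μ] [IsProbabilityMeasure ν]
  {R : Set (Z × Z)} {s : ℝ}

open BoundedContinuousFunction

/-- The cone of all functions that dominate a trivially nonnegative combination of centred
potentials and of `1_R - (1 - s)`. -/
def dualCone (μ ν : Measure Z) [IsProbabilityMeasure μ] [IsProbabilityMeasure ν]
    (R : Set (Z × Z)) (s : ℝ) : PointedCone ℝ (Z × Z →ᵇ ℝ) where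
  carrier := {h | ∃ f g : Z →ᵇ ℝ, ∃ t : ℝ, 0 ≤ t ∧ ∀ p : Z × Z,
    f p.1 + g p.2 - ∫ x, f x ∂μ - ∫ x, g x ∂ν + t * (R.indicator 1 p - (1 - s)) ≤ h p}
  zero_mem' := ⟨0, 0, 0, le_rfl, by simp⟩
  add_mem' := by
    rintro h h' ⟨f, g, t, ht, H⟩ ⟨f', g', t', ht', H'⟩
    refine ⟨f + f', g + g', t + t', add_nonneg ht ht', fun p => ?_⟩
    simp only [coe_add, Pi.add_apply]
    rw [integral_add (f.integrable μ) (f'.integrable μ),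
      integral_add (g.integrable ν) (g'.integrable ν)]
    linarith [H p, H' p]
  smul_mem' := by
    rintro ⟨c, hc⟩ h ⟨f, g, t, ht, H⟩
    refine ⟨c • f, c • g, c * t, mul_nonneg hc ht, fun p => ?_⟩
    have e : ((⟨c, hc⟩ : {c : ℝ // 0 ≤ c}) • h) p = c * h p := rfl
    rw [e]
    simp only [coe_smul, smul_eq_mul]
    rw [integral_const_mul, integral_const_mul]
    have := mul_le_mul_of_nonneg_left (H p) hc
    linarith

theorem mem_dualCone {h : Z × Z →ᵇ ℝ} : h ∈ dualCone μ ν R s ↔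
    ∃ f g : Z →ᵇ ℝ, ∃ t : ℝ, 0 ≤ t ∧ ∀ p : Z × Z,
    f p.1 + g p.2 - ∫ x, f x ∂μ - ∫ x, g x ∂ν + t * (R.indicator 1 p - (1 - s)) ≤ h p := Iff.rfl

/-- Under the Hall-type condition, constants in the dual cone are nonnegative. -/
theorem nonneg_of_const_mem_dualCone [μ.InnerRegularCompactLTTop]
    (hs : ∀ K : Set Z, IsCompact K → μ.real K - ν.real (relImage R K) ≤ s) {c : ℝ}
    (hc : c • (1 : Z × Z →ᵇ ℝ) ∈ dualCone μ ν R s) : 0 ≤ c := by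
  obtain ⟨f, g, t, ht, H⟩ := mem_dualCone.1 hc
  simp only [coe_smul, coe_one, Pi.one_apply, smul_eq_mul, mul_one] at H
  -- With this constant, membership in the cone reads `t * 1_R ≤ (a - f) + (-g)`, and the integrals
  -- of these two potentials add up to `c + t * (1 - s)`.
  set a := c + ∫ x, f x ∂μ + ∫ x, g x ∂ν + t * (1 - s) with ha
  have key := mul_le_integral_add_integral hs (BoundedContinuousFunction.const Z a - f) (-g) t ht
    (fun x y => by
      have := H (x, y)
      have h0 : 0 ≤ t * R.indicator 1 (x, y) :=
        mul_nonneg ht (Set.indicator_nonneg (by simp) _)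
      simp only [coe_sub, coe_neg, Pi.sub_apply, Pi.neg_apply, const_apply]
      linarith) (fun p hp => by
      have := H p
      rw [Set.indicator_of_mem hp] at this
      simp only [coe_sub, coe_neg, Pi.sub_apply, Pi.neg_apply, const_apply]
      simp only [Pi.one_apply] at this
      linarith)
  simp only [coe_sub, coe_neg, Pi.sub_apply, Pi.neg_apply, const_apply] at key
  rw [integral_sub (integrable_const _) (f.integrable μ), integral_neg] at key
  simp only [integral_const, probReal_univ, one_smul] at key
  linarith

/-- The functional behind Strassen's coupling: positive, with the right marginals, and at least
`1 - s` on functions that dominate the indicator of `R`. -/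
theorem exists_functional_coupling [μ.InnerRegularCompactLTTop]
    (hs : ∀ K : Set Z, IsCompact K → μ.real K - ν.real (relImage R K) ≤ s) :
    ∃ L : (Z × Z →ᵇ ℝ) →ₗ[ℝ] ℝ, (∀ h, (∀ p, 0 ≤ h p) → 0 ≤ L h) ∧
      (∀ (f g : Z →ᵇ ℝ) (h : Z × Z →ᵇ ℝ), (∀ p, h p = f p.1 + g p.2) →
        L h = ∫ x, f x ∂μ + ∫ x, g x ∂ν) ∧
      ∀ h : Z × Z →ᵇ ℝ, (∀ p, R.indicator 1 p ≤ h p) → 1 - s ≤ L h := by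
  have : Nonempty Z := nonempty_of_isProbabilityMeasure μ
  have h1 : (1 : Z × Z →ᵇ ℝ) ≠ 0 := fun h => by
    obtain ⟨z⟩ := this
    simpa using DFunLike.congr_fun h (z, z)
  -- The functional `c • 1 ↦ c` on constants is extended; `‖h‖ • 1 + h` lies in the cone for every
  -- `h`, as the extension theorem requires.
  obtain ⟨L, hL1, hL⟩ := riesz_extension (dualCone μ ν R s)
    (LinearPMap.mkSpanSingleton (K := ℝ) (L := ℝ) (σ := RingHom.id ℝ)
      (1 : Z × Z →ᵇ ℝ) (1 : ℝ) h1) (by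
      rintro ⟨x, hx⟩ hxs
      obtain ⟨c, rfl⟩ := Submodule.mem_span_singleton.1 hx
      have := nonneg_of_const_mem_dualCone hs hxs
      exact (by simpa using this : (0 : ℝ) ≤ RingHom.id ℝ c • 1).trans_eq
        (LinearPMap.mkSpanSingleton'_apply _ _ _ c hx).symm) (by
      intro h
      refine ⟨⟨‖h‖ • 1, Submodule.smul_mem _ _ (Submodule.mem_span_singleton_self _)⟩, ?_⟩
      refine mem_dualCone.2 ⟨0, 0, 0, le_rfl, fun p => ?_⟩
      have := (abs_le.1 (h.norm_coe_le_norm p)).1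
      simp
      linarith)
  have hL1' : L 1 = 1 := by
    have := hL1 ⟨1, Submodule.mem_span_singleton_self _⟩
    rw [LinearPMap.mkSpanSingleton_apply] at this
    exact this
  have hmarg : ∀ (f g : Z →ᵇ ℝ) (h : Z × Z →ᵇ ℝ), (∀ p, h p = f p.1 + g p.2) →
      ∫ x, f x ∂μ + ∫ x, g x ∂ν ≤ L h := by
    intro f g h hfg
    have := hL (h - (∫ x, f x ∂μ + ∫ x, g x ∂ν) • 1) (mem_dualCone.2
      ⟨f, g, 0, le_rfl, fun p => by simp [hfg]; linarith⟩)
    rw [map_sub, map_smul, hL1', smul_eq_mul] at this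
    linarith
  refine ⟨L, fun h hh => hL h (mem_dualCone.2 ⟨0, 0, 0, le_rfl, by simpa using hh⟩),
    fun f g h hfg => le_antisymm ?_ (hmarg f g h hfg), fun h hh => ?_⟩
  · have := hmarg (-f) (-g) (-h) fun p => by simp [hfg]; ring
    simp only [coe_neg, Pi.neg_apply, integral_neg, map_neg] at this
    linarith
  · have := hL (h - (1 - s) • 1) (mem_dualCone.2
      ⟨0, 0, 1, zero_le_one, fun p => by simpa using hh p⟩)
    rw [map_sub, map_smul, hL1', smul_eq_mul] at this
    linarith

/-- **Strassen's theorem** for a closed relation on a locally compact separable space: if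
`μ K ≤ ν (R[K]) + s` for all compact `K`, some coupling gives mass at most `s` to `Rᶜ`. -/
theorem exists_coupling_compl_le [T2Space Z] [LocallyCompactSpace Z] [SecondCountableTopology Z]
    (hR : IsClosed R)
    (hs : ∀ K : Set Z, IsCompact K → μ.real K - ν.real (relImage R K) ≤ s) :
    ∃ π : Measure (Z × Z), IsCoupling π μ ν ∧ π.real Rᶜ ≤ s := by
  let : MetricSpace Z := TopologicalSpace.metrizableSpaceMetric Z
  obtain ⟨L, hpos, hmarg, hLR⟩ := exists_functional_coupling hs
  obtain ⟨π, hfin, hπ⟩ := exists_measure_of_tight L hpos (by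
    intro δ hδ
    obtain ⟨K₁, -, hK₁, hμ⟩ := MeasurableSet.univ.exists_isCompact_sdiff_lt
      (measure_ne_top μ Set.univ) (ε := ENNReal.ofReal (δ / 2)) (by simpa using hδ)
    obtain ⟨K₂, -, hK₂, hν⟩ := MeasurableSet.univ.exists_isCompact_sdiff_lt
      (measure_ne_top ν Set.univ) (ε := ENNReal.ofReal (δ / 2)) (by simpa using hδ)
    obtain ⟨ψ, h1, -, hc, h01⟩ := exists_continuous_one_zero_of_isCompact (hK₁.union hK₂)
      isClosed_empty (Set.disjoint_empty _)
    let f : Z →ᵇ ℝ := BoundedContinuousFunction.ofNormedAddCommGroup (fun x => 1 - ψ x)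
      (by fun_prop) 1 fun x => by
        have := h01 x
        rw [Real.norm_eq_abs, abs_of_nonneg (sub_nonneg.2 this.2)]
        linarith [this.1]
    have hf : ∀ x, f x = 1 - ψ x := fun _ => rfl
    have hint : ∀ (m : Measure Z) [IsProbabilityMeasure m] (K : Set Z), IsCompact K →
        K ⊆ K₁ ∪ K₂ → m (Set.univ \ K) < ENNReal.ofReal (δ / 2) → ∫ x, f x ∂m ≤ δ / 2 := by
      intro m _ K hK hsub hm
      have hmeas : MeasurableSet (Set.univ \ K) := MeasurableSet.univ.diff hK.measurableSet
      have hind : ∫ x, f x ∂m ≤ ∫ x, (Set.univ \ K).indicator 1 x ∂m := by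
        refine integral_mono (f.integrable m) ?_ fun x => ?_
        · exact (integrable_const (1 : ℝ)).indicator hmeas
        · by_cases hx : x ∈ K
          · simp [hx, hf, h1 (hsub hx)]
          · simpa [hx, hf] using (h01 x).1
      rw [integral_indicator_one hmeas] at hind
      exact hind.trans (ENNReal.toReal_le_of_le_ofReal (by linarith) hm.le)
    refine ⟨tsupport ψ ×ˢ tsupport ψ, hc.isCompact.prod hc.isCompact, fun h hh hK => ?_⟩
    -- Off the product of the supports one `ψ` factor vanishes, so `F ≥ 1 ≥ h` there. As a sum of
    -- potentials, `F` has `L F` determined by the marginals.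
    let F : Z × Z →ᵇ ℝ := f.compContinuous ⟨Prod.fst, continuous_fst⟩ +
      f.compContinuous ⟨Prod.snd, continuous_snd⟩
    have hF : ∀ p, F p = f p.1 + f p.2 := fun _ => rfl
    have hhF : L h ≤ L F := by
      have := hpos (F - h) fun p => by
        simp only [coe_sub, Pi.sub_apply, hF, hf]
        by_cases hp : p ∈ tsupport ψ ×ˢ tsupport ψ
        · rw [hK p hp]
          linarith [(h01 p.1).2, (h01 p.2).2]
        · have : ψ p.1 = 0 ∨ ψ p.2 = 0 := by
            by_contra hne
            push Not at hne
            exact hp ⟨subset_tsupport _ hne.1, subset_tsupport _ hne.2⟩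
          rcases this with e | e <;> rw [e] <;> linarith [(h01 p.1).2, (h01 p.2).2, (hh p).2]
      rw [map_sub] at this
      linarith
    rw [hmarg f f F hF] at hhF
    linarith [hint μ K₁ hK₁ Set.subset_union_left hμ, hint ν K₂ hK₂ Set.subset_union_right hν])
  have hcoup : IsCoupling π μ ν := by
    constructor
    · refine ext_of_forall_integral_eq_of_IsFiniteMeasure fun f => ?_
      rw [integral_map measurable_fst.aemeasurable f.continuous.aestronglyMeasurable]
      have e := hmarg f 0 (f.compContinuous ⟨Prod.fst, continuous_fst⟩) fun p => by simp
      rw [← hπ] at e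
      simpa using e
    · refine ext_of_forall_integral_eq_of_IsFiniteMeasure fun f => ?_
      rw [integral_map measurable_snd.aemeasurable f.continuous.aestronglyMeasurable]
      have e := hmarg 0 f (f.compContinuous ⟨Prod.snd, continuous_snd⟩) fun p => by simp
      rw [← hπ] at e
      simpa using e
  have hprob : IsProbabilityMeasure π := by
    refine ⟨?_⟩
    have : π.map Prod.fst Set.univ = 1 := by rw [hcoup.1]; exact measure_univ
    rwa [Measure.map_apply measurable_fst MeasurableSet.univ, Set.preimage_univ] at this
  refine ⟨π, hcoup, ?_⟩
  rw [probReal_compl_eq_one_sub hR.measurableSet]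
  -- Since `R` is closed, its indicator is a limit of continuous functions dominating it, on which
  -- `L` is at least `1 - s`.
  have hle : ENNReal.ofReal (1 - s) ≤ π R := by
    refine ge_of_tendsto' (HasOuterApproxClosed.tendsto_lintegral_apprSeq hR π) fun k => ?_
    let F : Z × Z →ᵇ ℝ := ⟨⟨fun x => (hR.apprSeq k x : ℝ),
      NNReal.continuous_coe.comp (hR.apprSeq k).continuous⟩, (hR.apprSeq k).map_bounded'⟩
    have hF : ∀ p, F p = hR.apprSeq k p := fun _ => rfl
    have h1 : 1 - s ≤ ∫ p, F p ∂π := by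
      rw [hπ]
      refine hLR F fun p => ?_
      by_cases hp : p ∈ R
      · have := HasOuterApproxClosed.apprSeq_apply_eq_one hR k hp
        simp [hp, hF, this]
      · simp [hp, hF]
    refine ENNReal.ofReal_le_of_le_toReal ?_
    rw [BoundedContinuousFunction.toReal_lintegral_coe_eq_integral]
    exact h1
  have := (ENNReal.ofReal_le_iff_le_toReal (measure_ne_top π R)).1 hle
  rw [measureReal_def]
  linarith

end

/-! ### Midpoints, erosions and dilations -/

section
variable {X : Type*} {d : X → X → ℝ}

theorem IsMetric.self_eq_zero (hd : IsMetric d) (x : X) : d x x = 0 := (hd.eq_zero_iff x x).2 rfl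

theorem IsMetric.nonneg (hd : IsMetric d) (x y : X) : 0 ≤ d x y := by
  have := hd.triangle x y x
  rw [hd.self_eq_zero, hd.symm y x] at this
  linarith

/-- Iterated approximate midpoints split a distance at all dyadic proportions. -/
theorem HasApproxMidpoints.exists_dyadic (hd : IsMetric d) (hm : HasApproxMidpoints d) (k : ℕ) :
    ∀ (x y : X) (r : ℝ), d x y < 2 ^ k * r → ∀ j : ℕ, j ≤ 2 ^ k →
      ∃ m, d x m ≤ j * r ∧ d m y ≤ (2 ^ k - j) * r := by
  induction k with
  | zero =>
    intro x y r h j hj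
    rw [pow_zero, one_mul] at h
    interval_cases j
    · exact ⟨x, by simp [hd.self_eq_zero], by simpa using h.le⟩
    · exact ⟨y, by simpa using h.le, by simp [hd.self_eq_zero]⟩
  | succ k ih =>
    intro x y r h j hj
    rw [pow_succ] at h hj
    obtain ⟨m, h1, h2⟩ := hm x y (2 ^ k * r) (by linarith)
    rw [pow_succ]
    rcases le_total j (2 ^ k) with hjk | hjk
    · obtain ⟨m', h3, h4⟩ := ih x m r h1 j hjk
      exact ⟨m', h3, by linarith [hd.triangle m' m y]⟩
    · obtain ⟨i, rfl⟩ := Nat.exists_eq_add_of_le hjk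
      obtain ⟨m', h3, h4⟩ := ih m y r h2 i (by omega)
      refine ⟨m', ?_, ?_⟩
      · push_cast
        linarith [hd.triangle x m m']
      · push_cast
        linarith

/-- In a space with approximate midpoints, a distance can be split in any proportion, up to an
arbitrarily small error. -/
theorem HasApproxMidpoints.exists_split (hd : IsMetric d) (hm : HasApproxMidpoints d) {x y : X}
    {a b : ℝ} (ha : 0 < a) (hb : 0 < b) (h : d x y < a + b) : ∃ m, d x m < a ∧ d m y < b := by
  obtain ⟨s, hs, hsab⟩ := exists_between h
  have hs0 : 0 < s := (hd.nonneg x y).trans_lt hs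
  by_cases hsa : s < a
  · exact ⟨y, hs.trans hsa, by rwa [hd.self_eq_zero]⟩
  push Not at hsa
  obtain ⟨k, hk⟩ := pow_unbounded_of_one_lt (s / (a + b - s)) (one_lt_two (α := ℝ))
  rw [div_lt_iff₀ (by linarith)] at hk
  have h2 : (0 : ℝ) < 2 ^ k := by positivity
  set N : ℝ := 2 ^ k with hN
  -- `j` is the last step with `j * s / N < a`. The remaining length is at most `s - a + s / N`,
  -- which is below `b` because `s < N * (a + b - s)`.
  obtain ⟨j, hj⟩ : ∃ j, ⌈N * a / s⌉₊ = j + 1 :=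
    Nat.exists_eq_succ_of_ne_zero (Nat.ceil_pos.2 (by positivity)).ne'
  have hj1 : (j : ℝ) < N * a / s := Nat.lt_ceil.1 (by omega)
  have hj2 : N * a / s ≤ j + 1 := by
    have := Nat.le_ceil (N * a / s)
    rw [hj] at this
    exact_mod_cast this
  rw [lt_div_iff₀ hs0] at hj1
  rw [div_le_iff₀ hs0] at hj2
  have hjN : j ≤ 2 ^ k := by
    have : (j : ℝ) * s < N * s := hj1.trans_le (mul_le_mul_of_nonneg_left hsa h2.le)
    have := lt_of_mul_lt_mul_right this hs0.le
    rw [hN] at this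
    exact_mod_cast this.le
  obtain ⟨m, h3, h4⟩ := hm.exists_dyadic hd k x y (s / N) (by rwa [← hN, mul_div_cancel₀ _ h2.ne'])
    j hjN
  refine ⟨m, h3.trans_lt ?_, h4.trans_lt ?_⟩
  · rw [mul_div_assoc', div_lt_iff₀ h2]
    linarith
  · rw [← hN, mul_div_assoc', div_lt_iff₀ h2]
    linarith

theorem distToSet_le (A : Set X) (x : X) {y : X} (hy : y ∈ A) : distToSet d x A ≤ d x y :=
  iInf₂_le y hy

theorem distToSet_nonneg (hd : IsMetric d) (A : Set X) (x : X) : 0 ≤ distToSet d x A :=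
  le_iInf₂ fun y _ => by exact_mod_cast hd.nonneg x y

theorem mem_offset_of_mem {A : Set X} {x : X} (hx : x ∈ A) {s : ℝ} :
    x ∈ offset d A s ↔ -distToSet d x Aᶜ ≤ s := by
  simp [offset, signedDistTo, hx]

theorem mem_offset_of_notMem {A : Set X} {x : X} (hx : x ∉ A) {s : ℝ} :
    x ∈ offset d A s ↔ distToSet d x A ≤ s := by
  simp [offset, signedDistTo, hx]

/-- The closed `2ε`-neighbourhood of the erosion `B^{-ε}` is inside the dilation `B^ε`. -/
theorem mem_offset_of_le (hd : IsMetric d) (hm : HasApproxMidpoints d) {ε : ℝ} (hε : 0 ≤ ε)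
    {B : Set X} {x y : X} (hx : x ∈ offset d B (-ε)) (hxy : d x y ≤ 2 * ε) :
    y ∈ offset d B ε := by
  -- Splitting needs positive lengths; for `ε = 0` the points coincide, and so do the two offsets.
  rcases hε.eq_or_lt with rfl | hε
  · have : x = y := (hd.eq_zero_iff x y).1 (le_antisymm (by simpa using hxy) (hd.nonneg x y))
    rw [neg_zero] at hx
    exact this ▸ hx
  have hxB : x ∈ B := by
    by_contra hxB
    have := (distToSet_nonneg hd B x).trans ((mem_offset_of_notMem hxB).1 hx)
    have : (0 : ℝ) ≤ -ε := by exact_mod_cast this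
    linarith
  rw [mem_offset_of_mem hxB, EReal.coe_neg, EReal.neg_le_neg_iff] at hx
  by_cases hyB : y ∈ B
  · rw [mem_offset_of_mem hyB]
    refine (EReal.neg_le_neg_iff.2 (distToSet_nonneg hd Bᶜ y)).trans ?_
    rw [neg_zero]
    exact_mod_cast hε.le
  rw [mem_offset_of_notMem hyB]
  refine EReal.le_of_forall_lt_iff_le.1 fun z hz => ?_
  have hz : ε < z := by exact_mod_cast hz
  -- A point closer than `ε` to `x` cannot leave `B`, so `m` witnesses that `y` is within `z` of
  -- `B`.
  obtain ⟨m, h1, h2⟩ := hm.exists_split hd hε (hε.trans hz) (x := x) (y := y) (by linarith)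
  have hmB : m ∈ B := by
    by_contra hmB
    have := hx.trans (distToSet_le Bᶜ x hmB)
    have : ε ≤ d x m := by exact_mod_cast this
    linarith
  refine (distToSet_le B y hmB).trans ?_
  rw [hd.symm]
  exact_mod_cast h2.le

/-- The relation of being at distance at most `r`. -/
def closeRel (d : X → X → ℝ) (r : ℝ) : Set (X × X) := {p | d p.1 p.2 ≤ r}

/-- The erosion of the closed `ε`-neighbourhood of `K` contains `K`. -/
theorem subset_offset_neg_relImage (hd : IsMetric d) {ε : ℝ} (hε : 0 ≤ ε) (K : Set X) :
    K ⊆ offset d (relImage (closeRel d ε) K) (-ε) := by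
  intro x hx
  have hxB : x ∈ relImage (closeRel d ε) K := ⟨x, hx, by simpa [closeRel, hd.self_eq_zero]⟩
  rw [mem_offset_of_mem hxB, EReal.coe_neg, EReal.neg_le_neg_iff]
  refine le_iInf₂ fun y hy => ?_
  by_contra h
  push Not at h
  have h : d x y < ε := by exact_mod_cast h
  exact hy ⟨x, hx, h.le⟩

section
variable [TopologicalSpace X]

theorem isClosed_closeRel (hc : Continuous fun p : X × X => d p.1 p.2) (r : ℝ) :
    IsClosed (closeRel d r) := isClosed_le hc continuous_const

/-- The distance to a compact set is attained. -/
theorem mem_relImage_of_distToSet_le (hd : IsMetric d) (hc : Continuous fun p : X × X => d p.1 p.2)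
    {K : Set X} (hK : IsCompact K) {x : X} {r : ℝ} (h : distToSet d x K ≤ r) :
    x ∈ relImage (closeRel d r) K := by
  -- The distance to the empty set is `+∞`, which no real `r` bounds.
  have hne : K.Nonempty := by
    rw [Set.nonempty_iff_ne_empty]
    rintro rfl
    simp [distToSet] at h
  have hcx : Continuous fun y => d x y := hc.comp (by fun_prop : Continuous fun y => (x, y))
  obtain ⟨y, hy, hmin⟩ := hK.exists_isMinOn hne hcx.continuousOn
  refine ⟨y, hy, ?_⟩
  have : (d x y : EReal) ≤ distToSet d x K := le_iInf₂ fun z hz => by exact_mod_cast hmin hz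
  have : d x y ≤ r := by exact_mod_cast this.trans h
  rwa [closeRel, Set.mem_ofPred_eq, hd.symm]

/-- For compact `K`, dilating the closed `ε`-neighbourhood of `K` by `ε` stays in the closed
`2ε`-neighbourhood. -/
theorem offset_relImage_subset (hd : IsMetric d) (hc : Continuous fun p : X × X => d p.1 p.2)
    {ε : ℝ} (hε : 0 ≤ ε) {K : Set X} (hK : IsCompact K) :
    offset d (relImage (closeRel d ε) K) ε ⊆ relImage (closeRel d (2 * ε)) K := by
  intro x hx
  by_cases hxB : x ∈ relImage (closeRel d ε) K
  · obtain ⟨k, hk, hkx⟩ := hxB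
    refine ⟨k, hk, ?_⟩
    simp only [closeRel, Set.mem_ofPred_eq] at hkx ⊢
    linarith
  rw [mem_offset_of_notMem hxB] at hx
  -- Compactness of `K` turns an infimum at most `2ε` into an actual point, so a bound by every `z >
  -- 2ε` suffices.
  refine mem_relImage_of_distToSet_le hd hc hK ?_
  refine EReal.le_of_forall_lt_iff_le.1 fun z hz => ?_
  have hz : 2 * ε < z := by exact_mod_cast hz
  have hlt : distToSet d x (relImage (closeRel d ε) K) < ((z - ε : ℝ) : EReal) :=
    hx.trans_lt (by exact_mod_cast (by linarith : ε < z - ε))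
  obtain ⟨y, hy⟩ := iInf_lt_iff.1 hlt
  obtain ⟨⟨k, hk, hky⟩, hy⟩ := iInf_lt_iff.1 hy
  have hy : d x y < z - ε := by exact_mod_cast hy
  refine (distToSet_le K x hk).trans ?_
  have : d k y ≤ ε := hky
  have h3 := hd.triangle x y k
  rw [hd.symm y k] at h3
  exact_mod_cast (by linarith : d x k ≤ z)

/-- An infimum of continuous functions, even an uncountable one, is upper semicontinuous; hence `A`
may be arbitrary. -/
theorem measurable_distToSet [MeasurableSpace X] [OpensMeasurableSpace X]
    (hc : Continuous fun p : X × X => d p.1 p.2) (A : Set X) :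
    Measurable fun x => distToSet d x A := by
  refine UpperSemicontinuous.measurable (upperSemicontinuous_biInf fun y _ => ?_)
  refine Continuous.upperSemicontinuous ?_
  exact continuous_coe_real_ereal.comp (hc.comp (by fun_prop : Continuous fun x => (x, y)))

theorem measurableSet_offset [MeasurableSpace X] [OpensMeasurableSpace X]
    (hc : Continuous fun p : X × X => d p.1 p.2) {A : Set X} (hA : MeasurableSet A) (s : ℝ) :
    MeasurableSet (offset d A s) := by
  classical
  have : Measurable (signedDistTo d A) :=
    Measurable.ite hA (measurable_distToSet hc Aᶜ).neg (measurable_distToSet hc A)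
  exact this measurableSet_Iic

end
end

/-! ### The maximal gain and its symmetry -/

section
variable {X : Type*} {d : X → X → ℝ} [MeasurableSpace X]

/-- The difference between the `m`-mass of the erosion and the `m'`-mass of the dilation. -/
noncomputable def gain (d : X → X → ℝ) (ε : ℝ) (m m' : Measure X) (B : Set X) : ℝ :=
  m.real (offset d B (-ε)) - m'.real (offset d B ε)

/-- The largest gain over all measurable sets. -/
noncomputable def maxGain (d : X → X → ℝ) (ε : ℝ) (m m' : Measure X) : ℝ :=
  ⨆ B : {B : Set X // MeasurableSet B}, gain d ε m m' B

variable {ε : ℝ} {m m' : Measure X}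

theorem bddAbove_gain [IsFiniteMeasure m] :
    BddAbove (Set.range fun B : {B : Set X // MeasurableSet B} => gain d ε m m' B) := by
  refine ⟨m.real Set.univ, ?_⟩
  rintro _ ⟨B, rfl⟩
  exact (sub_le_self _ measureReal_nonneg).trans (measureReal_mono (Set.subset_univ _))

theorem gain_le_maxGain [IsFiniteMeasure m] {B : Set X} (hB : MeasurableSet B) : gain d ε m m' B ≤ maxGain d ε m m' :=
  le_ciSup bddAbove_gain (⟨B, hB⟩ : {B : Set X // MeasurableSet B})

theorem maxGain_le {c : ℝ} (h : ∀ B, MeasurableSet B → gain d ε m m' B ≤ c) :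
    maxGain d ε m m' ≤ c :=
  have : Nonempty {B : Set X // MeasurableSet B} := ⟨⟨∅, MeasurableSet.empty⟩⟩
  ciSup_le fun B => h B B.2

theorem exists_isCompact_measureReal_le [IsFiniteMeasure m] [TopologicalSpace X] [m.InnerRegularCompactLTTop]
    {A : Set X} (hA : MeasurableSet A) {δ : ℝ} (hδ : 0 < δ) :
    ∃ K ⊆ A, IsCompact K ∧ m.real A ≤ m.real K + δ := by
  obtain ⟨K, hKA, hK, h⟩ := hA.exists_isCompact_lt_add (measure_ne_top m _)
    (ε := ENNReal.ofReal δ) (by simpa using hδ)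
  refine ⟨K, hKA, hK, ?_⟩
  have := ENNReal.toReal_mono (by finiteness) h.le
  rwa [ENNReal.toReal_add (by finiteness) (by finiteness), ENNReal.toReal_ofReal hδ.le] at this

variable [IsFiniteMeasure m] [IsFiniteMeasure m'] [TopologicalSpace X] [OpensMeasurableSpace X]

/-- Strassen-type differences over compact sets are bounded by the maximal gain. -/
theorem sub_relImage_le_maxGain (hd : IsMetric d) (hc : Continuous fun p : X × X => d p.1 p.2)
    (hε : 0 ≤ ε) {K : Set X} (hK : IsCompact K) :
    m.real K - m'.real (relImage (closeRel d (2 * ε)) K) ≤ maxGain d ε m m' := by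
  -- The competitor lies halfway: eroding it by `ε` still covers `K`, dilating it by `ε` stays
  -- within `2ε` of `K`.
  refine le_trans ?_ (gain_le_maxGain (B := relImage (closeRel d ε) K)
    (isClosed_relImage (isClosed_closeRel hc ε) hK).measurableSet)
  exact sub_le_sub (measureReal_mono (subset_offset_neg_relImage hd hε K))
    (measureReal_mono (offset_relImage_subset hd hc hε hK))

/-- Passing to complements exchanges the two measures. -/
theorem maxGain_le_maxGain_swap (hd : IsMetric d) (hc : Continuous fun p : X × X => d p.1 p.2)
    (hm : HasApproxMidpoints d) (hε : 0 ≤ ε) [T2Space X]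
    [m.InnerRegularCompactLTTop] [m'.InnerRegularCompactLTTop] :
    maxGain d ε m m' ≤ maxGain d ε m' m + m.real Set.univ - m'.real Set.univ := by
  refine maxGain_le fun B hB => le_of_forall_pos_le_add fun δ hδ => ?_
  obtain ⟨K, hKB, hK, hKm⟩ := exists_isCompact_measureReal_le (m := m)
    (measurableSet_offset hc hB (-ε)) (half_pos hδ)
  set N := relImage (closeRel d (2 * ε)) K with hN
  have hNm : MeasurableSet N :=
    (isClosed_relImage (isClosed_closeRel hc (2 * ε)) hK).measurableSet
  have hNB : N ⊆ offset d B ε := by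
    rintro y ⟨x, hx, hxy⟩
    exact mem_offset_of_le hd hm hε (hKB hx) hxy
  obtain ⟨K', hKN', hK', hKm'⟩ := exists_isCompact_measureReal_le (m := m') hNm.compl
    (half_pos hδ)
  -- The relation is symmetric, so points outside the neighbourhood `N` of `K` cannot reach `K`.
  -- Hence `K'` is a competitor for the exchanged measures.
  have hsub : relImage (closeRel d (2 * ε)) K' ⊆ Kᶜ := by
    rintro y ⟨x, hx, hxy⟩ hy
    refine hKN' hx ⟨y, hy, ?_⟩
    simpa [closeRel, hd.symm y x] using hxy
  have h1 := sub_relImage_le_maxGain (m := m') (m' := m) hd hc hε hK'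
  have h2 : m.real (relImage (closeRel d (2 * ε)) K') ≤ m.real Kᶜ := measureReal_mono hsub
  have h3 : m'.real N ≤ m'.real (offset d B ε) := measureReal_mono hNB
  have h4 := measureReal_compl (μ := m) hK.measurableSet
  have h5 := measureReal_compl (μ := m') hNm
  rw [gain]
  linarith

end

/-! ### Duality for labelled points -/

section
variable {n : ℕ}

/-- The part of `ν` with label `i`. -/
noncomputable def labelPart (ν : Measure (Labelled n)) (i : Fin 2) : Measure (RSpace n) :=
  (ν.restrict (Set.univ ×ˢ {i})).map Prod.fst

variable (ν : Measure (Labelled n))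

instance [IsFiniteMeasure ν] (i : Fin 2) : IsFiniteMeasure (labelPart ν i) := by
  unfold labelPart
  infer_instance

theorem labelPart_real {E : Set (RSpace n)} (hE : MeasurableSet E) (i : Fin 2) :
    (labelPart ν i).real E = ν.real (E ×ˢ {i}) := by
  rw [labelPart, measureReal_def, Measure.map_apply measurable_fst hE,
    Measure.restrict_apply (measurable_fst hE), measureReal_def]
  congr 2
  ext z
  simp

variable [IsProbabilityMeasure ν]

theorem measureReal_eq_add_labelPart {S : Set (Labelled n)} (hS : MeasurableSet S) :
    ν.real S = (labelPart ν 0).real {x | (x, 0) ∈ S} + (labelPart ν 1).real {x | (x, 1) ∈ S} := by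
  have hm : ∀ i : Fin 2, MeasurableSet {x | (x, i) ∈ S} := fun i => measurable_prodMk_right hS
  rw [labelPart_real ν (hm 0), labelPart_real ν (hm 1), ← measureReal_union]
  · congr 1
    ext ⟨x, i⟩
    fin_cases i <;> simp
  · rw [Set.disjoint_left]
    rintro ⟨x, i⟩ ⟨-, h⟩ ⟨-, h'⟩
    simp_all
  · exact (hm 1).prod (measurableSet_singleton 1)

theorem measurable_labelSwap :
    Measurable fun z : Labelled n => (z.1, Equiv.swap (0 : Fin 2) 1 z.2) :=
  measurable_fst.prodMk ((measurable_of_finite _).comp measurable_snd)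

instance : IsProbabilityMeasure (labelSwap ν) :=
  Measure.isProbabilityMeasure_map measurable_labelSwap.aemeasurable

theorem labelSwap_real_eq_add {S : Set (Labelled n)} (hS : MeasurableSet S) :
    (labelSwap ν).real S =
      (labelPart ν 1).real {x | (x, 0) ∈ S} + (labelPart ν 0).real {x | (x, 1) ∈ S} := by
  rw [labelSwap, map_measureReal_apply measurable_labelSwap hS,
    measureReal_eq_add_labelPart ν (measurable_labelSwap hS), add_comm]
  simp

/-- The pairs of labelled points at cost zero. -/
def freeRel (d : RSpace n → RSpace n → ℝ) (ε : ℝ) : Set (Labelled n × Labelled n) :=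
  {p | d p.1.1 p.2.1 ≤ 2 * ε ∧ p.1.2 = p.2.2}

variable {d : RSpace n → RSpace n → ℝ} {ε : ℝ}

theorem isClosed_freeRel (hc : Continuous fun p : RSpace n × RSpace n => d p.1 p.2) :
    IsClosed (freeRel d ε) := by
  refine IsClosed.and (isClosed_le (f := fun p : Labelled n × Labelled n => d p.1.1 p.2.1) ?_
    continuous_const) (isClosed_eq (by fun_prop) (by fun_prop))
  exact hc.comp (by fun_prop : Continuous fun p : Labelled n × Labelled n => (p.1.1, p.2.1))

theorem integral_advCost (hc : Continuous fun p : RSpace n × RSpace n => d p.1 p.2)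
    (π : Measure (Labelled n × Labelled n)) :
    ∫ z, advCost d ε z.1 z.2 ∂π = π.real (freeRel d ε)ᶜ := by
  rw [← integral_indicator_one (isClosed_freeRel hc).measurableSet.compl]
  congr 1
  ext z
  by_cases hz : z ∈ freeRel d ε
  · have : ¬(d z.1.1 z.2.1 > 2 * ε ∨ z.1.2 ≠ z.2.2) := by
      push Not
      exact hz
    simp [advCost, hz, this]
  · have : d z.1.1 z.2.1 > 2 * ε ∨ z.1.2 ≠ z.2.2 := by
      by_contra h
      push Not at h
      exact hz h
    simp [advCost, hz, this]

/-- Free moves keep the label, so the Strassen condition decouples into one condition per label. -/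
theorem slice_relImage_freeRel (K : Set (Labelled n)) (i : Fin 2) :
    {x | (x, i) ∈ relImage (freeRel d ε) K} =
      relImage (closeRel d (2 * ε)) {x | (x, i) ∈ K} := by
  ext y
  constructor
  · rintro ⟨⟨x, j⟩, hx, h1, h2⟩
    obtain rfl : j = i := h2
    exact ⟨x, hx, h1⟩
  · rintro ⟨x, hx, h1⟩
    exact ⟨(x, i), hx, h1, rfl⟩

theorem isCompact_slice {K : Set (Labelled n)} (hK : IsCompact K) (i : Fin 2) :
    IsCompact {x | (x, i) ∈ K} := by
  have : {x | (x, i) ∈ K} = Prod.fst '' (K ∩ Prod.snd ⁻¹' {i}) := by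
    ext x
    simp
  rw [this]
  exact (hK.inter_right ((isClosed_discrete {i}).preimage continuous_snd)).image continuous_fst

/-- A coupling whose cost is at most the sum of the two maximal gains. -/
theorem exists_coupling_integral_advCost_le (hd : IsMetric d)
    (hc : Continuous fun p : RSpace n × RSpace n => d p.1 p.2) (hε : 0 ≤ ε) :
    ∃ π : Measure (Labelled n × Labelled n), IsCoupling π ν (labelSwap ν) ∧
      ∫ z, advCost d ε z.1 z.2 ∂π ≤ maxGain d ε (labelPart ν 0) (labelPart ν 1) +
        maxGain d ε (labelPart ν 1) (labelPart ν 0) := by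
  obtain ⟨π, hπ, h⟩ := exists_coupling_compl_le (μ := ν) (ν := labelSwap ν)
    (isClosed_freeRel (ε := ε) hc) (s := maxGain d ε (labelPart ν 0) (labelPart ν 1) +
        maxGain d ε (labelPart ν 1) (labelPart ν 0)) fun K hK => by
      rw [measureReal_eq_add_labelPart ν hK.measurableSet, labelSwap_real_eq_add ν
        (isClosed_relImage (isClosed_freeRel hc) hK).measurableSet, slice_relImage_freeRel,
        slice_relImage_freeRel]
      have h0 := sub_relImage_le_maxGain (m := labelPart ν 0) (m' := labelPart ν 1) hd hc hε
        (isCompact_slice hK 0)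
      have h1 := sub_relImage_le_maxGain (m := labelPart ν 1) (m' := labelPart ν 0) hd hc hε
        (isCompact_slice hK 1)
      linarith
  exact ⟨π, hπ, by rwa [integral_advCost hc]⟩

/-- Weak duality: every coupling costs at least the sum of two gains. -/
theorem gain_add_gain_le_integral_advCost (hd : IsMetric d)
    (hc : Continuous fun p : RSpace n × RSpace n => d p.1 p.2) (hm : HasApproxMidpoints d)
    (hε : 0 ≤ ε) {π : Measure (Labelled n × Labelled n)} (hπ : IsCoupling π ν (labelSwap ν))
    {A B : Set (RSpace n)} (hA : MeasurableSet A) (hB : MeasurableSet B) :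
    gain d ε (labelPart ν 0) (labelPart ν 1) A + gain d ε (labelPart ν 1) (labelPart ν 0) B ≤
      ∫ z, advCost d ε z.1 z.2 ∂π := by
  have hprob : IsProbabilityMeasure π := by
    refine ⟨?_⟩
    have : π.map Prod.fst Set.univ = 1 := by rw [hπ.1]; exact measure_univ
    rwa [Measure.map_apply measurable_fst MeasurableSet.univ, Set.preimage_univ] at this
  let S : ℝ → Set (Labelled n) := fun s => offset d A s ×ˢ {0} ∪ offset d B s ×ˢ {1}
  have hS : ∀ s, MeasurableSet (S s) := fun s =>
    ((measurableSet_offset hc hA s).prod (measurableSet_singleton 0)).union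
      ((measurableSet_offset hc hB s).prod (measurableSet_singleton 1))
  have e0 : ∀ s, {x | (x, 0) ∈ S s} = offset d A s := fun s => by
    ext x
    simp [S]
  have e1 : ∀ s, {x | (x, 1) ∈ S s} = offset d B s := fun s => by
    ext x
    simp [S]
  have h1 := measureReal_eq_add_labelPart ν (hS (-ε))
  have h2 := labelSwap_real_eq_add ν (hS ε)
  rw [e0, e1] at h1 h2
  have h3 : ν.real (S (-ε)) = π.real (Prod.fst ⁻¹' S (-ε)) := by
    rw [← map_measureReal_apply measurable_fst (hS _), hπ.1]
  have h4 : (labelSwap ν).real (S ε) = π.real (Prod.snd ⁻¹' S ε) := by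
    rw [← map_measureReal_apply measurable_snd (hS _), hπ.2]
  -- Mass starting in the erosion either pays cost 1 or ends in the dilation with the same label.
  have hsub : Prod.fst ⁻¹' S (-ε) ⊆ (freeRel d ε)ᶜ ∪ Prod.snd ⁻¹' S ε := by
    rintro ⟨⟨x, i⟩, ⟨y, j⟩⟩ hx
    by_cases hf : ((x, i), (y, j)) ∈ freeRel d ε
    · right
      obtain ⟨hxy, hij⟩ := hf
      obtain rfl : i = j := hij
      rcases hx with ⟨hx, hi⟩ | ⟨hx, hi⟩
      · exact Or.inl ⟨mem_offset_of_le hd hm hε hx hxy, hi⟩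
      · exact Or.inr ⟨mem_offset_of_le hd hm hε hx hxy, hi⟩
    · exact Or.inl hf
  have h5 := (measureReal_mono (μ := π) hsub).trans (measureReal_union_le _ _)
  rw [integral_advCost hc, gain, gain]
  linarith

/-- Kantorovich duality for the adversarial cost. -/
theorem iInf_integral_advCost (hd : IsMetric d)
    (hc : Continuous fun p : RSpace n × RSpace n => d p.1 p.2) (hm : HasApproxMidpoints d)
    (hε : 0 ≤ ε) :
    (⨅ π : {π : Measure (Labelled n × Labelled n) // IsCoupling π ν (labelSwap ν)},
      ∫ z, advCost d ε z.1 z.2 ∂π.1) = maxGain d ε (labelPart ν 0) (labelPart ν 1) +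
        maxGain d ε (labelPart ν 1) (labelPart ν 0) := by
  obtain ⟨π, hπ, hle⟩ := exists_coupling_integral_advCost_le ν hd hc hε
  have hge : ∀ π : {π : Measure (Labelled n × Labelled n) // IsCoupling π ν (labelSwap ν)},
      maxGain d ε (labelPart ν 0) (labelPart ν 1) + maxGain d ε (labelPart ν 1) (labelPart ν 0) ≤
        ∫ z, advCost d ε z.1 z.2 ∂π.1 := fun π => by
    rw [← le_sub_iff_add_le]
    refine maxGain_le fun A hA => ?_
    rw [le_sub_comm]
    refine maxGain_le fun B hB => ?_
    rw [le_sub_iff_add_le']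
    exact gain_add_gain_le_integral_advCost ν hd hc hm hε π.2 hA hB
  have : Nonempty {π : Measure (Labelled n × Labelled n) // IsCoupling π ν (labelSwap ν)} :=
    ⟨⟨π, hπ⟩⟩
  refine le_antisymm ?_ (le_ciInf hge)
  exact (ciInf_le ⟨_, Set.forall_mem_range.2 hge⟩ ⟨π, hπ⟩).trans hle

end

/-! ### From densities to label parts, and the conclusion -/

section
variable {n : ℕ} (ν : Measure (Labelled n)) {d : RSpace n → RSpace n → ℝ} {ε : ℝ}

theorem setIntegral_classWeight_mul {ρ : RSpace n → ℝ} (hρ : IsProbDensity ρ) {i : Fin 2}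
    (hν : HasConditionalDensity ν i ρ) {E : Set (RSpace n)} (hE : MeasurableSet E) :
    ∫ x in E, classWeight ν i * ρ x = (labelPart ν i).real E := by
  rw [integral_const_mul, labelPart_real ν hE, measureReal_def ν, hν E hE, ENNReal.toReal_mul,
    integral_eq_lintegral_of_nonneg_ae (.of_forall hρ.nonneg) hρ.measurable.aestronglyMeasurable]
  rfl

theorem robustGain_eq_gain (hc : Continuous fun p : RSpace n × RSpace n => d p.1 p.2)
    {ρ ρ' : RSpace n → ℝ} (hρ : IsProbDensity ρ) (hρ' : IsProbDensity ρ') {i j : Fin 2}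
    (hi : HasConditionalDensity ν i ρ) (hj : HasConditionalDensity ν j ρ') {B : Set (RSpace n)}
    (hB : MeasurableSet B) :
    robustGain d ε (fun x => classWeight ν i * ρ x) (fun x => classWeight ν j * ρ' x) B =
      gain d ε (labelPart ν i) (labelPart ν j) B := by
  rw [robustGain, gain, setIntegral_classWeight_mul ν hρ hi (measurableSet_offset hc hB _),
    setIntegral_classWeight_mul ν hρ' hj (measurableSet_offset hc hB _)]

end

theorem mainTheorem2 (n : ℕ) (d : RSpace n → RSpace n → ℝ) (hd : IsMetric d)
    (hd_cont : Continuous fun p : RSpace n × RSpace n => d p.1 p.2)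
    (hd_mid : HasApproxMidpoints d)
    (ε : ℝ) (hε : 0 ≤ ε)
    (ν : Measure (Labelled n)) (hν : IsProbabilityMeasure ν)
    (ρ₀ ρ₁ : RSpace n → ℝ) (hρ₀ : IsProbDensity ρ₀) (hρ₁ : IsProbDensity ρ₁)
    (hν₀ : HasConditionalDensity ν 0 ρ₀) (hν₁ : HasConditionalDensity ν 1 ρ₁)
    (w₀ w₁ : ℝ) (hw₀ : w₀ = classWeight ν 0) (hw₁ : w₁ = classWeight ν 1) :
    BddAbove (Set.range fun B : {B : Set (RSpace n) // MeasurableSet B} =>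
      robustGain d ε (fun x => w₁ * ρ₁ x) (fun x => w₀ * ρ₀ x) B) ∧
    BddAbove (Set.range fun A : {A : Set (RSpace n) // MeasurableSet A} =>
      robustGain d ε (fun x => w₀ * ρ₀ x) (fun x => w₁ * ρ₁ x) A) ∧
    2 * (⨆ B : {B : Set (RSpace n) // MeasurableSet B},
          robustGain d ε (fun x => w₁ * ρ₁ x) (fun x => w₀ * ρ₀ x) B) - w₁ + w₀ =
      (⨅ π : {π : Measure (Labelled n × Labelled n) // IsCoupling π ν (labelSwap ν)},
          ∫ z, advCost d ε z.1 z.2 ∂π.1) ∧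
    2 * (⨆ A : {A : Set (RSpace n) // MeasurableSet A},
          robustGain d ε (fun x => w₀ * ρ₀ x) (fun x => w₁ * ρ₁ x) A) - w₀ + w₁ =
      (⨅ π : {π : Measure (Labelled n × Labelled n) // IsCoupling π ν (labelSwap ν)},
          ∫ z, advCost d ε z.1 z.2 ∂π.1) := by

  subst hw₀ hw₁
  have e₁ : (fun B : {B : Set (RSpace n) // MeasurableSet B} =>
      robustGain d ε (fun x => classWeight ν 1 * ρ₁ x) (fun x => classWeight ν 0 * ρ₀ x) B) =
      fun B : {B : Set (RSpace n) // MeasurableSet B} => gain d ε (labelPart ν 1) (labelPart ν 0) B.1 :=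
    funext fun B => robustGain_eq_gain ν hd_cont hρ₁ hρ₀ hν₁ hν₀ B.2
  have e₀ : (fun A : {A : Set (RSpace n) // MeasurableSet A} =>
      robustGain d ε (fun x => classWeight ν 0 * ρ₀ x) (fun x => classWeight ν 1 * ρ₁ x) A) =
      fun A : {A : Set (RSpace n) // MeasurableSet A} => gain d ε (labelPart ν 0) (labelPart ν 1) A.1 :=
    funext fun A => robustGain_eq_gain ν hd_cont hρ₀ hρ₁ hν₀ hν₁ A.2
  have hw : ∀ i, (labelPart ν i).real Set.univ = classWeight ν i := fun i =>
    labelPart_real ν MeasurableSet.univ i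
  -- The two opposite inequalities force the maximal gains to differ by exactly `w₀ - w₁`.
  have h₀ := maxGain_le_maxGain_swap (m := labelPart ν 0) (m' := labelPart ν 1) hd hd_cont
    hd_mid hε
  have h₁ := maxGain_le_maxGain_swap (m := labelPart ν 1) (m' := labelPart ν 0) hd hd_cont
    hd_mid hε
  rw [hw, hw] at h₀ h₁
  rw [e₁, e₀, iInf_integral_advCost ν hd hd_cont hd_mid hε]
  refine ⟨bddAbove_gain, bddAbove_gain, ?_, ?_⟩
  · change 2 * maxGain d ε (labelPart ν 1) (labelPart ν 0) - _ + _ = _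
    linarith
  · change 2 * maxGain d ε (labelPart ν 0) (labelPart ν 1) - _ + _ = _
    linarith
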